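/- Let $\Omega\subseteq\mathbb R^2$ be measurable, $\lambda\ge 0$ an integrable density on $\Omega$ with $\int_\Omega\lambda=1$, $p_1,\dots,p_K\in\mathbb R^2$ ($K\ge 1$), $d_i(x)=|x-p_i|$ the Euclidean distance, and $F:[0,\infty)\to\mathbb R$ continuous such that $F(d_i)\,\lambda$ is integrable on $\Omega$ for every $i$ (automatic if $\Omega$ is bounded). Let $s_1,\dots,s_K:[0,1]\to\mathbb R$ be continuously differentiable, non-decreasing and convex. A cell partition of $\Omega$ is a family $(C_1,\dots,C_K)$ of measurable sets with $\bigcup_i C_i=\Omega$ and $\int_{C_i\cap C_j}\lambda=0$ for $i\ne j$; write $N_i=\int_{C_i}\lambda$. Consider the problem $$\mathrm{(P1)}\qquad \min_{(C_i)\text{ cell partition of }\Omega}\ \sum_{i=1}^K\int_{C_i}\bigl[F(d_i(x))+s_i(N_i)\bigr]\lambda(x)\,dx .$$ (a) (P1) has a solution $(C_i)$ with pairwise disjoint cells such that, for $L_i(x)=F(d_i(x))+s_i(N_i)+N_i\,s_i'(N_i)$ and every $i$, $$\{x\in\Omega: L_i(x)<L_j(x)\ \forall j\ne i\}\ \subseteq\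 C_i\ \subseteq\ \{x\in\Omega: L_i(x)\le L_j(x)\ \forall j\}.$$ That is, $C_i$ is the set of points where $L_i$ is minimal over all indices, points where several indices are minimal being assigned to one of these indices. (b) If moreover the points $p_i$ are distinct and every level set $\{r\ge 0: F(r)=c\}$, $c\in\mathbb R$, has Lebesgue measure zero (for example, if $F$ is strictly monotone), then (P1) has a solution $(C_i)$ that satisfies $$\mathrm{(S1)}\qquad C_i=\{x\in\Omega: F(d_i(x))+s_i(N_i)+N_i\,s_i'(N_i)\le F(d_j(x))+s_j(N_j)+N_j\,s_j'(N_j)\ \forall j\},\qquad N_i=\int_{C_i}\lambda,$$ for every $i$. -/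

import Mathlib

open MeasureTheory Set

namespace CellAssociation

/-- The Euclidean plane. -/
abbrev Plane : Type := EuclideanSpace ℝ (Fin 2)

/-- The mass `∬_A lam` of a region `A` under the density `lam`. -/
noncomputable def mass (lam : Plane → ℝ) (A : Set Plane) : ℝ :=
  ∫ x in A, lam x

/-- `C` is a cell partition of `Ω`: measurable cells that cover `Ω` exactly and whose pairwise
overlaps carry no mass (cells given by non-strict inequalities share their boundaries). -/
structure IsCellPartition {K : ℕ} (Ω : Set Plane) (lam : Plane → ℝ)
    (C : Fin K → Set Plane) : Prop where
  measurable : ∀ i, MeasurableSet (C i)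
  cover : ⋃ i, C i = Ω
  overlap : ∀ i j, i ≠ j → mass lam (C i ∩ C j) = 0

/-- The objective of (P1), with base stations at the points `p i`:
`∑ i, ∬_{C i} [F (d_i) + s_i (N_i)] lam`, where `N_i` is the mass of `C i`. -/
noncomputable def cost {K : ℕ} (p : Fin K → Plane) (lam : Plane → ℝ) (F : ℝ → ℝ)
    (s : Fin K → ℝ → ℝ) (C : Fin K → Set Plane) : ℝ :=
  ∑ i, ∫ x in C i, (F (dist x (p i)) + s i (mass lam (C i))) * lam x

/-- `C` solves (P1): it is a cell partition of least cost among all cell partitions of `Ω`. -/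
def SolvesP1 {K : ℕ} (Ω : Set Plane) (p : Fin K → Plane) (lam : Plane → ℝ) (F : ℝ → ℝ)
    (s : Fin K → ℝ → ℝ) (C : Fin K → Set Plane) : Prop :=
  IsCellPartition Ω lam C ∧
    ∀ D : Fin K → Set Plane, IsCellPartition Ω lam D → cost p lam F s C ≤ cost p lam F s D

/-- `F (d_i x) + s_i (N_i) + N_i * s_i' (N_i)`; the derivative is that of `s_i` as a function on
`[0, 1]`, so one-sided at the end points. -/
noncomputable def level {K : ℕ} (p : Fin K → Plane) (F : ℝ → ℝ) (s : Fin K → ℝ → ℝ)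
    (N : Fin K → ℝ) (i : Fin K) (x : Plane) : ℝ :=
  F (dist x (p i)) + s i (N i) + N i * derivWithin (s i) (Icc 0 1) (N i)

/-- The points of `Ω` at which the level of index `i` is minimal among all indices. -/
def minCell {K : ℕ} (Ω : Set Plane) (p : Fin K → Plane) (F : ℝ → ℝ) (s : Fin K → ℝ → ℝ)
    (N : Fin K → ℝ) (i : Fin K) : Set Plane :=
  {x | x ∈ Ω ∧ ∀ j, level p F s N i x ≤ level p F s N j x}

/-- The points of `Ω` at which the level of index `i` is the only minimal one. -/
def strictMinCell {K : ℕ} (Ω : Set Plane) (p : Fin K → Plane) (F : ℝ → ℝ) (s : Fin K → ℝ → ℝ)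
    (N : Fin K → ℝ) (i : Fin K) : Set Plane :=
  {x | x ∈ Ω ∧ ∀ j, j ≠ i → level p F s N i x < level p F s N j x}

end CellAssociation

/-! Let μ be the measure with density `lam` on Ω, put f_i = F(d_i) and G_i(t) = t s_i(t), and let
Φ(v) = ∫ min_i (f_i + v_i) dμ, a concave function of the prices v. Its conjugate T(N) = sup_w (Φ(w)
− ⟨w, N⟩) is the dual form of the least transport cost with prescribed cell masses N.

Existence: T + ∑ G_i attains its minimum on the simplex at some N. The first-order condition there,
compared with a minimal selection at the prices v_i = G_i'(N_i), says that N is a supergradient of Φ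
at v (`exists_supergradient_at_marginal_cost`). As μ charges no vertical line, tie sets can be
divided in any proportions, and a separation argument shows that every supergradient is the mass
vector of a selection of minimal indices (`exists_selection_of_supergradient`). Its fibers are the
cells, and v is then the price vector of their own masses.

Sufficiency: such cells minimize the cost linearized at N, and each G_i lies above its tangents, so
they minimize the true cost (`solvesP1_of_subset_minCell`). Convexity of s_i enters only here.

For (b), ties are null: off the line through two centers, the two distances determine a point up to
reflection, and by Fubini the tied pairs of radii are null (`volume_tie_eq_zero`). The full minimal
cells thus have the same masses. -/

namespace CellAssociation

open Filter Topology

/-! ### Measurable selections and the masses of their fibers -/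

section Selection

variable {X ι : Type*} [MeasurableSpace X] [MeasurableSpace ι]

/-- A finite measurable cover admits a measurable choice of a member at every point. -/
lemma exists_measurable_selection [Finite ι] [Nonempty ι] {S : ι → Set X}
    (hS : ∀ i, MeasurableSet (S i)) (hcov : ∀ x, ∃ i, x ∈ S i) :
    ∃ σ : X → ι, Measurable σ ∧ ∀ x, x ∈ S (σ x) := by
  classical
  cases nonempty_fintype ι
  have key : ∀ s : Finset ι, ∃ σ : X → ι, Measurable σ ∧ ∀ x, (∃ i ∈ s, x ∈ S i) → x ∈ S (σ x) := by
    intro s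
    induction s using Finset.induction_on with
    | empty => exact ⟨fun _ => Classical.arbitrary ι, measurable_const, by simp⟩
    | insert a s _ ih =>
      obtain ⟨σ, hσ, hσS⟩ := ih
      refine ⟨fun x => if x ∈ S a then a else σ x,
        Measurable.ite (hS a) measurable_const hσ, fun x hx => ?_⟩
      by_cases hxa : x ∈ S a
      · simp [hxa]
      · simp only [hxa, if_false]
        refine hσS x ?_
        obtain ⟨i, hi, hxi⟩ := hx
        rcases Finset.mem_insert.1 hi with rfl | hi
        · exact absurd hxi hxa
        · exact ⟨i, hi, hxi⟩
  obtain ⟨σ, hσ, hσS⟩ := key Finset.univ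
  exact ⟨σ, hσ, fun x => hσS x (by simpa using hcov x)⟩

/-- The integral of a function of a finitely valued map. -/
lemma integral_comp_eq_sum_measureReal_fiber [Fintype ι] [DiscreteMeasurableSpace ι]
    (μ : Measure X) [IsFiniteMeasure μ]
    {σ : X → ι} (hσ : Measurable σ) (u : ι → ℝ) :
    ∫ x, u (σ x) ∂μ = ∑ i, u i * μ.real (σ ⁻¹' {i}) := by
  rw [← integral_map (φ := σ) (f := u) hσ.aemeasurable
    (measurable_of_finite u).aestronglyMeasurable, integral_fintype Integrable.of_finite]
  refine Finset.sum_congr rfl fun i _ => ?_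
  rw [map_measureReal_apply hσ (measurableSet_singleton i), smul_eq_mul, mul_comm]

lemma sum_measureReal_inter_fiber [Fintype ι] [DiscreteMeasurableSpace ι]
    (μ : Measure X) [IsFiniteMeasure μ]
    {σ : X → ι} (hσ : Measurable σ) (E : Set X) :
    ∑ i, μ.real (E ∩ σ ⁻¹' {i}) = μ.real E := by
  have h := integral_comp_eq_sum_measureReal_fiber (μ.restrict E) hσ (fun _ => (1 : ℝ))
  simp only [integral_const, smul_eq_mul, mul_one, one_mul] at h
  rw [measureReal_restrict_apply_univ] at h
  rw [h]
  refine Finset.sum_congr rfl fun i _ => ?_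
  rw [measureReal_restrict_apply (hσ (measurableSet_singleton i)), inter_comm]

end Selection

/-! ### Dividing sets in prescribed proportions -/

section Splitting

variable {X : Type*} [MeasurableSpace X]

/-- If the fibers of a measurable real function are null, then every measurable set has
measurable subsets of every smaller mass. -/
lemma exists_measurableSet_subset_measureReal_eq (μ : Measure X) [IsFiniteMeasure μ] {q : X → ℝ}
    (hq : Measurable q) (hq0 : ∀ t, μ (q ⁻¹' {t}) = 0) {E : Set X} (hE : MeasurableSet E) {m : ℝ}
    (hm0 : 0 ≤ m) (hm : m ≤ μ.real E) :
    ∃ B ⊆ E, MeasurableSet B ∧ μ.real B = m := by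
  rcases hm0.eq_or_lt with rfl | hm0
  · exact ⟨∅, empty_subset _, MeasurableSet.empty, by simp⟩
  rcases hm.eq_or_lt with rfl | hm
  · exact ⟨E, Subset.rfl, hE, rfl⟩
  -- The distribution function of `q` on `E` is continuous because `ν` has no atoms. It runs from 0
  -- to the mass of `E`, so some sublevel set of `q` has mass `m`.
  set ν : Measure ℝ := (μ.restrict E).map q with hν
  have hfin : IsFiniteMeasure ν := by rw [hν]; infer_instance
  have hatom : NullSingletonClass ν := ⟨fun t => by
    rw [hν, Measure.map_apply hq (measurableSet_singleton t)]
    exact Measure.absolutelyContinuous_of_le Measure.restrict_le_self (hq0 t)⟩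
  have hreal : ∀ t, ν.real (Iic t) = μ.real (E ∩ q ⁻¹' Iic t) := fun t => by
    rw [hν, map_measureReal_apply hq measurableSet_Iic,
      measureReal_restrict_apply (hq measurableSet_Iic), inter_comm]
  have huniv : ν.real univ = μ.real E := by
    rw [hν, map_measureReal_apply hq MeasurableSet.univ]; simp
  have hcont : Continuous fun t => ν.real (Iic t) := by
    rw [continuous_iff_continuousAt]
    intro t
    have h := IntegrableOn.continuousOn_Iic_primitive_Iic (μ := ν) (f := fun _ => (1 : ℝ))
      (a₀ := t + 1) (integrable_const (1 : ℝ)).integrableOn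
    have h2 := h.continuousAt (Iic_mem_nhds (lt_add_one t))
    simpa using h2
  have htop : Tendsto (fun t => ν.real (Iic t)) atTop (𝓝 (ν.real univ)) :=
    (ENNReal.tendsto_toReal (measure_ne_top ν univ)).comp (tendsto_measure_Iic_atTop ν)
  have hbot : Tendsto (fun t => ν.real (Iic t)) atBot (𝓝 0) := by
    have h := ((ENNReal.tendsto_toReal (measure_ne_top ν univ)).comp
      (tendsto_measure_Ici_atBot ν)).const_sub (ν.real univ)
    have heq : ∀ t, ν.real (Iic t) = ν.real univ - (ν (Ici t)).toReal := fun t => by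
      rw [← compl_Ioi, measureReal_compl measurableSet_Ioi, measureReal_def ν (Ioi t),
        measure_congr Ioi_ae_eq_Ici]
    simpa only [heq, Function.comp_def, measureReal_def, sub_self] using h
  obtain ⟨b, hb⟩ := (htop.eventually (lt_mem_nhds (huniv ▸ hm))).exists
  obtain ⟨a, ha⟩ := (hbot.eventually (gt_mem_nhds hm0)).exists
  obtain ⟨t, ht⟩ := mem_range_of_exists_le_of_exists_ge hcont ⟨a, ha.le⟩ ⟨b, hb.le⟩
  exact ⟨E ∩ q ⁻¹' Iic t, inter_subset_left, hE.inter (hq measurableSet_Iic), by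
    rw [← hreal]; exact ht⟩

/-- A set can be divided among a nonempty finite set of indices in prescribed proportions. -/
lemma exists_measurable_split {ι : Type*} [MeasurableSpace ι] [DiscreteMeasurableSpace ι]
    (μ : Measure X) [IsFiniteMeasure μ] {q : X → ℝ}
    (hq : Measurable q) (hq0 : ∀ t, μ (q ⁻¹' {t}) = 0) {A : Finset ι} (hA : A.Nonempty)
    {E : Set X} (hE : MeasurableSet E) {m : ι → ℝ} (hm0 : ∀ i ∈ A, 0 ≤ m i)
    (hm : ∑ i ∈ A, m i = μ.real E) :
    ∃ σ : X → ι, Measurable σ ∧ (∀ x, σ x ∈ A) ∧ ∀ i ∈ A, μ.real (E ∩ σ ⁻¹' {i}) = m i := by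
  classical
  induction hA using Finset.Nonempty.cons_induction generalizing E with
  | singleton a =>
    refine ⟨fun _ => a, measurable_const, by simp, fun i hi => ?_⟩
    obtain rfl := Finset.mem_singleton.1 hi
    have : (fun _ : X => i) ⁻¹' {i} = univ := by ext; simp
    rw [this, inter_univ, ← hm, Finset.sum_singleton]
  | cons a s ha hs ih =>
    rw [Finset.sum_cons] at hm
    have hm0' : ∀ i ∈ s, 0 ≤ m i := fun i hi => hm0 i (Finset.mem_cons_of_mem hi)
    -- `B` is the share of `a`; the other indices divide `E \ B` by induction.
    obtain ⟨B, hBE, hB, hBm⟩ := exists_measurableSet_subset_measureReal_eq μ hq hq0 hE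
      (hm0 a (Finset.mem_cons_self a s))
      (by rw [← hm]; linarith [Finset.sum_nonneg hm0'])
    obtain ⟨σ, hσ, hσs, hσm⟩ := ih (hE.diff hB) hm0'
      (by rw [measureReal_sdiff hBE hB, hBm, ← hm]; ring)
    refine ⟨fun x => if x ∈ B then a else σ x, Measurable.ite hB measurable_const hσ,
      fun x => ?_, fun i hi => ?_⟩
    · by_cases hx : x ∈ B
      · simp [hx]
      · simpa [hx] using Or.inr (hσs x)
    · rcases Finset.mem_cons.1 hi with rfl | his
      · have : E ∩ (fun x => if x ∈ B then i else σ x) ⁻¹' {i} = B := by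
          ext x
          by_cases hx : x ∈ B
          · simp [hx, hBE hx]
          · have : σ x ≠ i := fun h => ha (h ▸ hσs x)
            simp [hx, this]
        rw [this, hBm]
      · rw [← hσm i his]
        congr 1
        ext x
        by_cases hx : x ∈ B
        · have : a ≠ i := fun h => ha (h ▸ his)
          simp [hx, this]
        · simp [hx]

end Splitting

/-! ### The envelope integral, its conjugate and the first-order condition -/

section DualFunction

variable {X ι : Type*} [MeasurableSpace X] [Fintype ι]

/-- The integral of the lower envelope of the functions `f i + v i`. -/
noncomputable def envelopeIntegral (μ : Measure X) (f : ι → X → ℝ) (v : ι → ℝ) : ℝ :=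
  ∫ x, ⨅ i, (f i x + v i) ∂μ

lemma iInf_eq_of_forall_le {a : ι → ℝ} {i : ι} (h : ∀ j, a i ≤ a j) : ⨅ j, a j = a i :=
  have : Nonempty ι := ⟨i⟩
  le_antisymm (ciInf_le (finite_range a).bddBelow i) (le_ciInf h)

lemma iInf_le_of_finite (a : ι → ℝ) (i : ι) : ⨅ j, a j ≤ a i :=
  ciInf_le (finite_range a).bddBelow i

lemma measurable_envelope {f : ι → X → ℝ} (hf : ∀ i, Measurable (f i)) (v : ι → ℝ) :
    Measurable fun x => ⨅ i, (f i x + v i) :=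
  Measurable.iInf fun i => (hf i).add_const (v i)

/-- At each point the envelope is one of finitely many integrable functions, hence is dominated by
the sum of their norms. -/
lemma integrable_envelope [Nonempty ι] {μ : Measure X} [IsFiniteMeasure μ] {f : ι → X → ℝ}
    (hf : ∀ i, Measurable (f i)) (hfi : ∀ i, Integrable (f i) μ) (v : ι → ℝ) :
    Integrable (fun x => ⨅ i, (f i x + v i)) μ := by
  have hi : ∀ i, Integrable (fun x => f i x + v i) μ := fun i => (hfi i).add (integrable_const _)
  refine (integrable_finsetSum Finset.univ fun i _ => (hi i).norm).mono'
    (measurable_envelope hf v).aestronglyMeasurable (Eventually.of_forall fun x => ?_)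
  obtain ⟨i, hmin⟩ := Finite.exists_min fun i => f i x + v i
  rw [iInf_eq_of_forall_le hmin]
  exact Finset.single_le_sum (f := fun i => ‖f i x + v i‖) (fun _ _ => norm_nonneg _)
    (Finset.mem_univ i)

/-- The envelope integral is bounded by weighted averages of the integrals. -/
lemma envelopeIntegral_le_sum [Nonempty ι] {μ : Measure X} [IsProbabilityMeasure μ]
    {f : ι → X → ℝ} (hf : ∀ i, Measurable (f i)) (hfi : ∀ i, Integrable (f i) μ) (v : ι → ℝ)
    {N : ι → ℝ} (hN : N ∈ stdSimplex ℝ ι) :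
    envelopeIntegral μ f v ≤ ∑ i, N i * ∫ x, f i x ∂μ + ∑ i, v i * N i := by
  have h : ∀ i, envelopeIntegral μ f v ≤ (∫ x, f i x ∂μ) + v i := fun i => by
    have : ∫ x, (f i x + v i) ∂μ = (∫ x, f i x ∂μ) + v i := by
      rw [integral_add (hfi i) (integrable_const _)]; simp
    rw [← this]
    exact integral_mono (integrable_envelope hf hfi v) ((hfi i).add (integrable_const _))
      fun x => iInf_le_of_finite _ i
  calc envelopeIntegral μ f v = ∑ i, N i * envelopeIntegral μ f v := by
        rw [← Finset.sum_mul, hN.2, one_mul]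
    _ ≤ ∑ i, N i * ((∫ x, f i x ∂μ) + v i) :=
        Finset.sum_le_sum fun i _ => mul_le_mul_of_nonneg_left (h i) (hN.1 i)
    _ = _ := by
        rw [← Finset.sum_add_distrib]
        exact Finset.sum_congr rfl fun i _ => by ring

/-- The masses of a selection of minimal indices form a supergradient of the envelope integral. -/
lemma envelopeIntegral_le_add_of_selection [MeasurableSpace ι] [DiscreteMeasurableSpace ι]
    [Nonempty ι] {μ : Measure X} [IsFiniteMeasure μ] {f : ι → X → ℝ}
    (hf : ∀ i, Measurable (f i)) (hfi : ∀ i, Integrable (f i) μ) {v : ι → ℝ} {σ : X → ι}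
    (hσ : Measurable σ) (hmin : ∀ x i, f (σ x) x + v (σ x) ≤ f i x + v i) (w : ι → ℝ) :
    envelopeIntegral μ f w
      ≤ envelopeIntegral μ f v + ∑ i, (w i - v i) * μ.real (σ ⁻¹' {i}) := by
  have hint : Integrable (fun x => w (σ x) - v (σ x)) μ :=
    (Integrable.of_finite (f := fun i => w i - v i) (μ := μ.map σ)).comp_measurable hσ
  rw [← integral_comp_eq_sum_measureReal_fiber μ hσ (fun i => w i - v i), envelopeIntegral,
    envelopeIntegral, ← integral_add (integrable_envelope hf hfi v) hint]
  refine integral_mono (integrable_envelope hf hfi w) ((integrable_envelope hf hfi v).add hint)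
    fun x => ?_
  have h1 := iInf_le_of_finite (fun i => f i x + w i) (σ x)
  have h2 := iInf_eq_of_forall_le (a := fun i => f i x + v i) (hmin x)
  simp only at *
  linarith

lemma exists_measurable_argmin [MeasurableSpace ι] [Nonempty ι] {f : ι → X → ℝ}
    (hf : ∀ i, Measurable (f i)) :
    ∃ σ : X → ι, Measurable σ ∧ ∀ x i, f (σ x) x ≤ f i x := by
  refine exists_measurable_selection (S := fun i => {x | ∀ j, f i x ≤ f j x}) (fun i => ?_)
    fun x => Finite.exists_min fun i => f i x
  simp only [ofPred_forall]
  exact MeasurableSet.iInter fun j => measurableSet_le (hf i) (hf j)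

lemma measureReal_fiber_mem_stdSimplex [MeasurableSpace ι] [DiscreteMeasurableSpace ι]
    {μ : Measure X} [IsProbabilityMeasure μ] {σ : X → ι} (hσ : Measurable σ) :
    (fun i => μ.real (σ ⁻¹' {i})) ∈ stdSimplex ℝ ι :=
  ⟨fun _ => measureReal_nonneg, by simpa using sum_measureReal_inter_fiber μ hσ univ⟩

lemma mem_Icc_of_mem_stdSimplex {N : ι → ℝ} (hN : N ∈ stdSimplex ℝ ι) (i : ι) :
    N i ∈ Icc (0 : ℝ) 1 :=
  ⟨hN.1 i, hN.2 ▸ Finset.single_le_sum (fun j _ => hN.1 j) (Finset.mem_univ i)⟩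

/-- There is a vector of masses `N` which is a supergradient of the envelope integral at the
vector of marginal congestion costs of `N`. It minimizes the sum of the congestion cost and of
the conjugate of the envelope integral. -/
theorem exists_supergradient_at_marginal_cost [Nonempty ι]
    {μ : Measure X} [IsProbabilityMeasure μ] {f : ι → X → ℝ} (hf : ∀ i, Measurable (f i))
    (hfi : ∀ i, Integrable (f i) μ) {G g : ι → ℝ → ℝ}
    (hG : ∀ i, ∀ t ∈ Icc (0 : ℝ) 1, HasDerivWithinAt (G i) (g i t) (Icc 0 1) t) :
    ∃ N ∈ stdSimplex ℝ ι, ∀ w : ι → ℝ, envelopeIntegral μ f w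
      ≤ envelopeIntegral μ f (fun i => g i (N i)) + ∑ i, (w i - g i (N i)) * N i := by
  classical
  -- A supremum of affine functions of `N`, hence convex and lower semicontinuous where finite. The
  -- real supremum is meaningful only where the family is bounded above; `hbdd` gives this on the
  -- simplex.
  set T : (ι → ℝ) → ℝ := fun N => ⨆ w : ι → ℝ, (envelopeIntegral μ f w - ∑ i, w i * N i) with hT
  have hbdd : ∀ N ∈ stdSimplex ℝ ι,
      BddAbove (range fun w : ι → ℝ => envelopeIntegral μ f w - ∑ i, w i * N i) := by
    rintro N hN
    refine ⟨∑ i, N i * ∫ x, f i x ∂μ, ?_⟩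
    rintro _ ⟨w, rfl⟩
    have := envelopeIntegral_le_sum hf hfi w hN
    simp only
    linarith
  have hle : ∀ N ∈ stdSimplex ℝ ι, ∀ w : ι → ℝ,
      envelopeIntegral μ f w - ∑ i, w i * N i ≤ T N := fun N hN w => le_ciSup (hbdd N hN) w
  have hlsc : LowerSemicontinuousOn (fun N => T N + ∑ i, G i (N i)) (stdSimplex ℝ ι) := by
    refine (lowerSemicontinuousOn_ciSup hbdd fun w => ?_).add ?_
    · exact Continuous.lowerSemicontinuous (by fun_prop) |>.lowerSemicontinuousOn _
    · refine ContinuousOn.lowerSemicontinuousOn (continuousOn_finsetSum _ fun i _ => ?_)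
      have hGc : ContinuousOn (G i) (Icc 0 1) := fun t ht => (hG i t ht).continuousWithinAt
      exact hGc.comp (continuous_apply i).continuousOn fun N hN => mem_Icc_of_mem_stdSimplex hN i
  obtain ⟨N, hN, hmin⟩ := hlsc.exists_isMinOn
    ⟨_, single_mem_stdSimplex ℝ (Classical.arbitrary ι)⟩ (isCompact_stdSimplex ℝ ι)
  refine ⟨N, hN, ?_⟩
  set v : ι → ℝ := fun i => g i (N i) with hv
  -- first-order condition at the minimizer
  have hfirst : ∀ M ∈ stdSimplex ℝ ι, T N + ∑ i, v i * N i ≤ T M + ∑ i, v i * M i := by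
    intro M hM
    -- `T` need not be differentiable, so along the segment from `N` to `M` it is replaced by its
    -- chord. Up to the constant `T N`, `φ` dominates the objective and agrees with it at 0; so 0
    -- minimizes `φ`, whose one-sided derivative there is nonnegative.
    set φ : ℝ → ℝ := fun t => t * (T M - T N) + ∑ i, G i (N i + t * (M i - N i)) with hφ
    have hmem : ∀ t ∈ Icc (0 : ℝ) 1, (fun i => N i + t * (M i - N i)) ∈ stdSimplex ℝ ι := by
      intro t ht
      convert convex_stdSimplex ℝ ι hN hM (sub_nonneg.2 ht.2) ht.1 (by ring) using 1
      ext i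
      simp only [Pi.add_apply, Pi.smul_apply, smul_eq_mul]
      ring
    have hTconv : ∀ t ∈ Icc (0 : ℝ) 1,
        T (fun i => N i + t * (M i - N i)) ≤ T N + t * (T M - T N) := by
      intro t ht
      refine ciSup_le fun w => ?_
      have h1 := mul_le_mul_of_nonneg_left (hle N hN w) (sub_nonneg.2 ht.2)
      have h2 := mul_le_mul_of_nonneg_left (hle M hM w) ht.1
      have h3 : ∑ i, w i * (N i + t * (M i - N i))
          = (1 - t) * ∑ i, w i * N i + t * ∑ i, w i * M i := by
        rw [Finset.mul_sum, Finset.mul_sum, ← Finset.sum_add_distrib]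
        exact Finset.sum_congr rfl fun i _ => by ring
      rw [h3]
      linarith
    have hφmin : IsMinOn φ (Icc 0 1) 0 := by
      intro t ht
      have h1 := hmin (hmem t ht)
      have h2 := hTconv t ht
      simp only [mem_ofPred_eq, hφ, zero_mul, add_zero, zero_add] at h1 ⊢
      linarith
    have hφd : HasDerivWithinAt φ (T M - T N + ∑ i, v i * (M i - N i)) (Icc 0 1) 0 := by
      refine HasDerivWithinAt.add ?_ (HasDerivWithinAt.fun_sum fun i _ => ?_)
      · simpa using (hasDerivWithinAt_id (0 : ℝ) (Icc 0 1)).mul_const (T M - T N)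
      · have hin : HasDerivWithinAt (fun t : ℝ => N i + t * (M i - N i)) (M i - N i)
            (Icc 0 1) 0 := by
          simpa using ((hasDerivWithinAt_id (0 : ℝ) (Icc 0 1)).mul_const
            (M i - N i)).const_add (N i)
        have hout : HasDerivWithinAt (G i) (v i) (Icc 0 1) (N i + 0 * (M i - N i)) := by
          simpa [hv] using hG i (N i) (mem_Icc_of_mem_stdSimplex hN i)
        exact hout.comp (0 : ℝ) hin fun t ht => mem_Icc_of_mem_stdSimplex (hmem t ht) i
    have hpos := hφmin.localize.hasFDerivWithinAt_nonneg hφd.hasFDerivWithinAt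
      (y := 1) (mem_posTangentConeAt_of_segment_subset (by simp [segment_eq_Icc]))
    have hsum : ∑ i, v i * (M i - N i) = ∑ i, v i * M i - ∑ i, v i * N i := by
      rw [← Finset.sum_sub_distrib]
      exact Finset.sum_congr rfl fun i _ => by ring
    simp only [ContinuousLinearMap.toSpanSingleton_apply, one_smul, hsum] at hpos
    linarith
  -- comparison with the masses of a selection of minimal indices
  let _ : MeasurableSpace ι := ⊤
  obtain ⟨σ, hσ, hσmin⟩ := exists_measurable_argmin fun i => (hf i).add_const (v i)
  have hM := measureReal_fiber_mem_stdSimplex (μ := μ) hσ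
  have h1 := hfirst _ hM
  have h2 : T (fun i => μ.real (σ ⁻¹' {i}))
      ≤ envelopeIntegral μ f v - ∑ i, v i * μ.real (σ ⁻¹' {i}) := by
    refine ciSup_le fun w => ?_
    have := envelopeIntegral_le_add_of_selection hf hfi hσ hσmin w
    simp only [sub_mul, Finset.sum_sub_distrib] at this
    linarith
  -- `h1` and `h2` give T(N) + ⟨v, N⟩ ≤ Φ(v), while T(N) is at least Φ(w) − ⟨w, N⟩.
  intro w
  have h3 := hle N hN w
  have hsum : ∑ i, (w i - g i (N i)) * N i = ∑ i, w i * N i - ∑ i, v i * N i := by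
    simp only [sub_mul, Finset.sum_sub_distrib, hv]
  rw [hsum]
  linarith

end DualFunction

/-! ### Supergradients as masses of tie-broken selections -/

section TieBreaking

variable {X ι : Type*} [MeasurableSpace X] [Fintype ι]

/-- The set of indices at which `a` is minimal. -/
noncomputable def argminSet (a : ι → ℝ) : Finset ι :=
  open scoped Classical in Finset.univ.filter fun i => ∀ j, a i ≤ a j

lemma mem_argminSet {a : ι → ℝ} {i : ι} : i ∈ argminSet a ↔ ∀ j, a i ≤ a j := by
  simp [argminSet]

lemma argminSet_nonempty [Nonempty ι] (a : ι → ℝ) : (argminSet a).Nonempty :=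
  (Finite.exists_min a).imp fun _ h => mem_argminSet.2 h

lemma measurableSet_mem_argminSet {a : ι → X → ℝ} (ha : ∀ i, Measurable (a i)) (i : ι) :
    MeasurableSet {x | i ∈ argminSet fun j => a j x} := by
  simp only [mem_argminSet, ofPred_forall]
  exact MeasurableSet.iInter fun j => measurableSet_le (ha i) (ha j)

lemma measurableSet_argminSet_eq {a : ι → X → ℝ} (ha : ∀ i, Measurable (a i)) (S : Finset ι) :
    MeasurableSet {x | (argminSet fun j => a j x) = S} := by
  simp only [Finset.ext_iff, ofPred_forall]
  refine MeasurableSet.iInter fun i => ?_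
  by_cases hi : i ∈ S
  · simpa [hi] using measurableSet_mem_argminSet ha i
  · simp only [hi, iff_false]
    exact (measurableSet_mem_argminSet ha i).compl

/-- A measurable selection of minimal indices which, among these, minimizes `u`. -/
lemma exists_measurable_lexicographic_argmin [MeasurableSpace ι] [Nonempty ι] {a : ι → X → ℝ}
    (ha : ∀ i, Measurable (a i)) (u : ι → ℝ) :
    ∃ σ : X → ι, Measurable σ ∧ ∀ x, σ x ∈ argminSet (fun j => a j x) ∧
      ∀ i ∈ argminSet (fun j => a j x), u (σ x) ≤ u i := by
  refine exists_measurable_selection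
    (S := fun i => {x | i ∈ argminSet (fun j => a j x) ∧
      ∀ k ∈ argminSet (fun j => a j x), u i ≤ u k}) (fun i => ?_) fun x => ?_
  · simp only [ofPred_and, ofPred_forall]
    refine (measurableSet_mem_argminSet ha i).inter ?_
    refine MeasurableSet.iInter fun k => ?_
    by_cases hk : u i ≤ u k
    · simp [hk]
    · simp only [hk, imp_false]
      exact (measurableSet_mem_argminSet ha k).compl
  · exact Finset.exists_min_image _ u (argminSet_nonempty _)

/-- Supplies the domination, uniform in the step size, of the difference quotients of the envelope.
-/
lemma abs_iInf_add_sub_iInf_le [Nonempty ι] (a b : ι → ℝ) :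
    |(⨅ i, (a i + b i)) - ⨅ i, a i| ≤ ∑ i, |b i| := by
  have hb : ∀ i, |b i| ≤ ∑ i, |b i| := fun i =>
    Finset.single_le_sum (f := fun i => |b i|) (fun _ _ => abs_nonneg _) (Finset.mem_univ i)
  obtain ⟨i, hi⟩ := Finite.exists_min a
  obtain ⟨j, hj⟩ := Finite.exists_min fun i => a i + b i
  rw [iInf_eq_of_forall_le hi, iInf_eq_of_forall_le hj, abs_le]
  have h1 := hi j
  have h2 := hj i
  have h3 := abs_le.1 (hb i)
  have h4 := abs_le.1 (hb j)
  constructor <;> linarith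

/-- For small perturbations of a vector in direction `u`, the minimum is attained at an index
which minimizes `u` among the indices that are minimal without perturbation. -/
lemma eventually_iInf_add_mul_eq {a u : ι → ℝ} {k : ι} (hk : k ∈ argminSet a)
    (hu : ∀ i ∈ argminSet a, u k ≤ u i) :
    ∀ᶠ t : ℝ in 𝓝[>] 0, ⨅ i, (a i + t * u i) = a k + t * u k := by
  have h : ∀ i, ∀ᶠ t : ℝ in 𝓝[>] 0, a k + t * u k ≤ a i + t * u i := by
    intro i
    by_cases hi : i ∈ argminSet a
    · filter_upwards [self_mem_nhdsWithin] with t ht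
      have h1 := mem_argminSet.1 hk i
      have h2 := mul_le_mul_of_nonneg_left (hu i hi) (le_of_lt ht)
      linarith
    · have hlt : a k < a i := by
        rw [mem_argminSet] at hi hk
        push Not at hi
        obtain ⟨j, hj⟩ := hi
        exact (hk j).trans_lt hj
      have h1 : Tendsto (fun t : ℝ => a k + t * u k) (𝓝[>] 0) (𝓝 (a k)) := by
        have : Continuous fun t : ℝ => a k + t * u k := by fun_prop
        simpa using (this.tendsto 0).mono_left nhdsWithin_le_nhds
      have h2 : Tendsto (fun t : ℝ => a i + t * u i) (𝓝[>] 0) (𝓝 (a i)) := by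
        have : Continuous fun t : ℝ => a i + t * u i := by fun_prop
        simpa using (this.tendsto 0).mono_left nhdsWithin_le_nhds
      exact (h1.eventually_lt h2 hlt).mono fun t => le_of_lt
  filter_upwards [eventually_all.2 h] with t ht
  exact iInf_eq_of_forall_le (a := fun i => a i + t * u i) ht

/-- The one-sided directional derivative of the envelope integral is bounded by supergradients. -/
lemma sum_mul_fiber_le_of_supergradient [MeasurableSpace ι] [DiscreteMeasurableSpace ι]
    [Nonempty ι] {μ : Measure X} [IsFiniteMeasure μ] {f : ι → X → ℝ}
    (hf : ∀ i, Measurable (f i)) (hfi : ∀ i, Integrable (f i) μ) {v N : ι → ℝ}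
    (hN : ∀ w : ι → ℝ, envelopeIntegral μ f w
      ≤ envelopeIntegral μ f v + ∑ i, (w i - v i) * N i)
    {u : ι → ℝ} {σ : X → ι} (hσ : Measurable σ)
    (hσv : ∀ x, σ x ∈ argminSet fun i => f i x + v i)
    (hσu : ∀ x, ∀ i ∈ argminSet (fun i => f i x + v i), u (σ x) ≤ u i) :
    ∑ i, u i * μ.real (σ ⁻¹' {i}) ≤ ∑ i, u i * N i := by
  rw [← integral_comp_eq_sum_measureReal_fiber μ hσ u]
  -- Right difference quotients of the envelope in direction `u`. They tend pointwise to `u (σ x)`,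
  -- and the supergradient inequality bounds their integrals by ⟨u, N⟩.
  set d : ℝ → X → ℝ := fun t x =>
    t⁻¹ * ((⨅ i, (f i x + (v i + t * u i))) - ⨅ i, (f i x + v i)) with hd
  have hlim : Tendsto (fun t => ∫ x, d t x ∂μ) (𝓝[>] 0) (𝓝 (∫ x, u (σ x) ∂μ)) := by
    refine tendsto_integral_filter_of_dominated_convergence (fun _ => ∑ i, |u i|)
      (Eventually.of_forall fun t => ?_) ?_ (integrable_const _) (Eventually.of_forall fun x => ?_)
    · exact (((measurable_envelope hf _).sub (measurable_envelope hf v)).const_mul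
        t⁻¹).aestronglyMeasurable
    · filter_upwards [self_mem_nhdsWithin] with t ht
      refine Eventually.of_forall fun x => ?_
      have ht : (0 : ℝ) < t := ht
      have h := abs_iInf_add_sub_iInf_le (fun i => f i x + v i) fun i => t * u i
      simp only [abs_mul, abs_of_pos ht, ← Finset.mul_sum, add_assoc] at h
      rw [Real.norm_eq_abs, hd, abs_mul, abs_of_pos (inv_pos.2 ht), inv_mul_le_iff₀ ht]
      exact h
    · refine tendsto_const_nhds.congr' ?_
      filter_upwards [eventually_iInf_add_mul_eq (hσv x) (hσu x), self_mem_nhdsWithin]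
        with t ht ht0
      have ht0 : (0 : ℝ) < t := ht0
      have h2 := iInf_eq_of_forall_le (mem_argminSet.1 (hσv x))
      simp only [add_assoc] at ht
      simp only [hd, ht, h2]
      field_simp
      ring
  refine le_of_tendsto hlim ?_
  filter_upwards [self_mem_nhdsWithin] with t ht
  have ht : (0 : ℝ) < t := ht
  have h := hN fun i => v i + t * u i
  have hsum : ∑ i, (v i + t * u i - v i) * N i = t * ∑ i, u i * N i := by
    rw [Finset.mul_sum]
    exact Finset.sum_congr rfl fun i _ => by ring
  rw [hsum] at h
  simp only [hd]
  rw [integral_const_mul, inv_mul_le_iff₀ ht,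
    integral_sub (integrable_envelope hf hfi _) (integrable_envelope hf hfi v)]
  simp only [envelopeIntegral] at h
  linarith

/-- Every supergradient of the envelope integral with respect to a diffuse measure is the vector
of masses of some selection of minimal indices. -/
theorem exists_selection_of_supergradient [MeasurableSpace ι] [DiscreteMeasurableSpace ι]
    [Nonempty ι] {μ : Measure X} [IsFiniteMeasure μ] {q : X → ℝ} (hq : Measurable q)
    (hq0 : ∀ t, μ (q ⁻¹' {t}) = 0) {f : ι → X → ℝ}
    (hf : ∀ i, Measurable (f i)) (hfi : ∀ i, Integrable (f i) μ) {v N : ι → ℝ}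
    (hN : ∀ w : ι → ℝ, envelopeIntegral μ f w
      ≤ envelopeIntegral μ f v + ∑ i, (w i - v i) * N i) :
    ∃ σ : X → ι, Measurable σ ∧ (∀ x i, f (σ x) x + v (σ x) ≤ f i x + v i) ∧
      ∀ i, μ.real (σ ⁻¹' {i}) = N i := by
  classical
  set A : X → Finset ι := fun x => argminSet fun i => f i x + v i with hA
  have hfv : ∀ i, Measurable fun x => f i x + v i := fun i => (hf i).add_const (v i)
  set E : Finset ι → Set X := fun S => {x | A x = S} with hE
  have hEm : ∀ S, MeasurableSet (E S) := measurableSet_argminSet_eq hfv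
  -- divisions of the tie sets among the tied indices
  set D : Set (Finset ι → ι → ℝ) :=
    {m | (∀ S i, 0 ≤ m S i) ∧ (∀ S, ∀ i ∉ S, m S i = 0) ∧ ∀ S, ∑ i, m S i = μ.real (E S)} with hD
  -- `Λ` adds up what each index receives from all tie sets, so `Λ '' D` consists of the mass
  -- vectors that tie-breaking can produce.
  set Λ : (Finset ι → ι → ℝ) →ₗ[ℝ] (ι → ℝ) := ∑ S, LinearMap.proj S with hΛ
  have hΛa : ∀ m i, Λ m i = ∑ S, m S i := fun m i => by simp [hΛ]
  have hDconv : Convex ℝ D := by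
    rintro m ⟨hm0, hmS, hms⟩ m' ⟨hm0', hmS', hms'⟩ a b ha hb hab
    refine ⟨fun S i => ?_, fun S i hi => ?_, fun S => ?_⟩
    · exact add_nonneg (mul_nonneg ha (hm0 S i)) (mul_nonneg hb (hm0' S i))
    · simp [hmS S i hi, hmS' S i hi]
    · simp only [Pi.add_apply, Pi.smul_apply, smul_eq_mul, Finset.sum_add_distrib,
        ← Finset.mul_sum, hms, hms']
      rw [← add_mul, hab, one_mul]
  have hDclosed : IsClosed D := by
    have hev : ∀ S i, Continuous fun m : Finset ι → ι → ℝ => m S i := fun S i => by fun_prop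
    simp only [hD, ofPred_and, ofPred_forall]
    refine IsClosed.inter ?_ (IsClosed.inter ?_ ?_)
    · exact isClosed_iInter fun S => isClosed_iInter fun i => isClosed_le continuous_const (hev S i)
    · exact isClosed_iInter fun S => isClosed_iInter fun i => isClosed_iInter fun _ =>
        isClosed_eq (hev S i) continuous_const
    · exact isClosed_iInter fun S => isClosed_eq (by fun_prop) continuous_const
  have hDcompact : IsCompact D := by
    refine (isCompact_Icc (a := (0 : Finset ι → ι → ℝ))
      (b := fun S _ => μ.real (E S))).of_isClosed_subset hDclosed ?_
    rintro m ⟨hm0, -, hms⟩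
    exact ⟨fun S i => hm0 S i, fun S i => (hms S).le.trans' <|
      Finset.single_le_sum (fun j _ => hm0 S j) (Finset.mem_univ i)⟩
  have hNmem : N ∈ Λ '' D := by
    -- A separating functional `u` would be strictly larger on all of `Λ '' D` than at `N`. Breaking
    -- ties in favor of small `u` gives a point of `Λ '' D` where it is at most ⟨u, N⟩, a
    -- contradiction.
    by_contra hnot
    obtain ⟨φ, c, hφN, hφc⟩ := geometric_hahn_banach_point_closed (hDconv.linear_image Λ)
      (hDcompact.image Λ.continuous_of_finiteDimensional).isClosed hnot
    set u : ι → ℝ := fun i => φ (Pi.single i 1) with hu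
    have hφu : ∀ M : ι → ℝ, φ M = ∑ i, u i * M i := fun M => by
      have := LinearMap.pi_apply_eq_sum_univ φ.toLinearMap M
      simp only [ContinuousLinearMap.coe_coe, smul_eq_mul] at this
      rw [this]
      refine Finset.sum_congr rfl fun i _ => ?_
      rw [mul_comm, hu]
      congr 2
      ext j
      simp [Pi.single_apply, eq_comm]
    obtain ⟨σ, hσ, hσA⟩ := exists_measurable_lexicographic_argmin hfv u
    have hmem : (fun i => μ.real (σ ⁻¹' {i})) ∈ Λ '' D := by
      refine ⟨fun S i => μ.real (E S ∩ σ ⁻¹' {i}), ⟨fun _ _ => measureReal_nonneg,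
        fun S i hi => ?_, fun S => sum_measureReal_inter_fiber μ hσ (E S)⟩, ?_⟩
      · have : E S ∩ σ ⁻¹' {i} = ∅ := by
          ext x
          simp only [mem_inter_iff, mem_preimage, mem_singleton_iff, mem_empty_iff_false,
            iff_false, not_and]
          rintro hx rfl
          exact hi (hx ▸ (hσA x).1)
        simp only [this, measureReal_empty]
      · ext i
        rw [hΛa]
        let _ : MeasurableSpace (Finset ι) := ⊤
        have hAm : Measurable A := measurable_to_countable' fun S => hEm S
        have h := sum_measureReal_inter_fiber μ hAm (σ ⁻¹' {i})
        rw [← h]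
        refine Finset.sum_congr rfl fun S _ => ?_
        rw [inter_comm]
        rfl
    have h1 := sum_mul_fiber_le_of_supergradient hf hfi hN hσ (fun x => (hσA x).1)
      fun x => (hσA x).2
    have h2 := hφc _ hmem
    rw [hφu] at hφN h2
    linarith
  obtain ⟨m, ⟨hm0, hmS, hms⟩, hmN⟩ := hNmem
  -- The division `m` is realized on each tie set separately. The empty `S` is never a set of
  -- minimal indices and gets a dummy selection.
  have hsplit : ∀ S : Finset ι, ∃ σ : X → ι, Measurable σ ∧ (S.Nonempty → (∀ x, σ x ∈ S) ∧
      ∀ i ∈ S, μ.real (E S ∩ σ ⁻¹' {i}) = m S i) := by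
    intro S
    by_cases hS : S.Nonempty
    · obtain ⟨σ, hσ, hσS, hσm⟩ := exists_measurable_split μ hq hq0 hS (hEm S) (m := m S)
        (fun i _ => hm0 S i) (by
          rw [← hms S]
          exact Finset.sum_subset (Finset.subset_univ S) fun i _ hi => hmS S i hi)
      exact ⟨σ, hσ, fun _ => ⟨hσS, hσm⟩⟩
    · exact ⟨fun _ => Classical.arbitrary ι, measurable_const, fun h => absurd h hS⟩
  choose τ hτ hτS using hsplit
  have hAne : ∀ x, (A x).Nonempty := fun x => argminSet_nonempty _
  let _ : MeasurableSpace (Finset ι) := ⊤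
  have hAm : Measurable A := measurable_to_countable' fun S => hEm S
  refine ⟨fun x => τ (A x) x, ?_, fun x i => ?_, fun i => ?_⟩
  · refine measurable_to_countable' fun i => ?_
    have : (fun x => τ (A x) x) ⁻¹' {i} = ⋃ S, (E S ∩ τ S ⁻¹' {i}) := by
      ext x
      simp [hE]
    rw [this]
    exact MeasurableSet.iUnion fun S => (hEm S).inter (hτ S (measurableSet_singleton i))
  · exact mem_argminSet.1 ((hτS (A x) (hAne x)).1 x) i
  · rw [← hmN, hΛa, ← sum_measureReal_inter_fiber μ hAm]
    refine Finset.sum_congr rfl fun S _ => ?_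
    have hset : (fun x => τ (A x) x) ⁻¹' {i} ∩ A ⁻¹' {S} = E S ∩ τ S ⁻¹' {i} := by
      ext x
      simp only [mem_inter_iff, mem_preimage, mem_singleton_iff, hE, mem_ofPred_eq]
      constructor
      · rintro ⟨h, rfl⟩; exact ⟨rfl, h⟩
      · rintro ⟨rfl, h⟩; exact ⟨h, rfl⟩
    rw [hset]
    by_cases hiS : i ∈ S
    · exact (hτS S ⟨i, hiS⟩).2 i hiS
    · rw [hmS S i hiS]
      have : E S ∩ τ S ⁻¹' {i} = ∅ := by
        ext x
        simp only [mem_inter_iff, mem_preimage, mem_singleton_iff, mem_empty_iff_false,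
          iff_false, not_and]
        rintro hx rfl
        have hx : A x = S := hx
        exact hiS ((hτS S (hx ▸ hAne x)).1 x)
      rw [this, measureReal_empty]

end TieBreaking

/-! ### Null sets in the plane and ties between distances -/

section PlaneGeometry

lemma measurePreserving_coordinates :
    MeasurePreserving (fun y : Plane => (y 0, y 1)) volume volume :=
  (volume_preserving_finTwoArrow ℝ).comp
    (EuclideanSpace.volume_preserving_symm_measurableEquiv_toLp (Fin 2))

lemma volume_preimage_coordinates_eq_zero {S : Set (ℝ × ℝ)} (hS : volume S = 0) :
    volume {y : Plane | (y 0, y 1) ∈ S} = 0 :=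
  measurePreserving_coordinates.quasiMeasurePreserving.preimage_null hS

lemma volume_coordinate_zero_eq (t : ℝ) : volume {y : Plane | y 0 = t} = 0 := by
  have h := volume_preimage_coordinates_eq_zero (S := {t} ×ˢ univ)
    (by rw [Measure.volume_eq_prod, Measure.prod_prod]; simp)
  simpa using h

lemma volume_coordinate_one_eq (t : ℝ) : volume {y : Plane | y 1 = t} = 0 := by
  have h := volume_preimage_coordinates_eq_zero (S := univ ×ˢ {t})
    (by rw [Measure.volume_eq_prod, Measure.prod_prod]; simp)
  simpa using h

lemma dist_sq_eq_coordinates (x y : Plane) :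
    dist x y ^ 2 = (x 0 - y 0) ^ 2 + (x 1 - y 1) ^ 2 := by
  rw [EuclideanSpace.dist_eq, Real.sq_sqrt (Finset.sum_nonneg fun _ _ => sq_nonneg _),
    Fin.sum_univ_two, Real.dist_eq, Real.dist_eq, sq_abs, sq_abs]

/-- If `F` has null level sets, the pairs of radii at which two values of `F` differ by a constant
form a null set. -/
lemma volume_radii_difference_eq_zero {F : ℝ → ℝ} (hF : ContinuousOn F (Ici 0))
    (hlevel : ∀ c : ℝ, volume {r : ℝ | 0 ≤ r ∧ F r = c} = 0) (c : ℝ) :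
    volume {z : ℝ × ℝ | 0 ≤ z.1 ∧ 0 ≤ z.2 ∧ F z.1 = F z.2 + c} = 0 := by
  -- Extending `F` by the constant `F 0` makes it continuous on the line, so the set in question is
  -- closed and Fubini applies; each slice with fixed first radius lies in a level set of `F`.
  set H : ℝ → ℝ := fun r => F (max r 0) with hH
  have hHc : Continuous H :=
    hF.comp_continuous (by fun_prop) fun r => le_max_right r 0
  have hHF : ∀ r, 0 ≤ r → H r = F r := fun r hr => by simp [hH, hr]
  have hclosed : IsClosed {z : ℝ × ℝ | 0 ≤ z.2 ∧ H z.1 = H z.2 + c} := by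
    rw [ofPred_and]
    exact (isClosed_le continuous_const continuous_snd).inter
      (isClosed_eq (by fun_prop) (by fun_prop))
  have hnull : volume {z : ℝ × ℝ | 0 ≤ z.2 ∧ H z.1 = H z.2 + c} = 0 := by
    rw [Measure.volume_eq_prod, Measure.measure_prod_null hclosed.measurableSet]
    refine Eventually.of_forall fun a => measure_mono_null ?_ (hlevel (H a - c))
    rintro b ⟨hb, hab⟩
    refine ⟨hb, ?_⟩
    simp only [hHF b hb] at hab
    linarith
  refine measure_mono_null ?_ hnull
  rintro ⟨a, b⟩ ⟨ha, hb, hab⟩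
  exact ⟨hb, by simpa only [hHF a ha, hHF b hb] using hab⟩

/-- The points of a line in parametric form are null. -/
lemma volume_line_eq_zero (p q : Plane) :
    volume {x : Plane | ∃ α : ℝ, x = p + α • q} = 0 := by
  have himg := addHaar_image_eq_zero_of_differentiableOn_of_addHaar_eq_zero
    (volume : Measure Plane) (f := fun y : Plane => p + y 0 • q) (s := {y : Plane | y 1 = 0})
    (by fun_prop) (volume_coordinate_one_eq 0)
  refine measure_mono_null ?_ himg
  rintro x ⟨α, rfl⟩
  exact ⟨!₂[α, 0], by simp, by simp⟩

/-- The set of points whose distances to two distinct points lie in a null set of pairs is null. -/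
lemma volume_dist_pair_eq_zero {p p' : Plane} (hp : p ≠ p') {S : Set (ℝ × ℝ)}
    (hS : volume S = 0) : volume {x : Plane | (dist x p, dist x p') ∈ S} = 0 := by
  set q : Plane := p' - p with hq
  set D : ℝ := q 0 ^ 2 + q 1 ^ 2 with hD
  have hDpos : 0 < D := by
    have h : dist p' p ^ 2 = D := by rw [dist_sq_eq_coordinates]; simp [hD, hq]
    rw [← h]
    exact pow_pos (dist_pos.2 hp.symm) 2
  -- `n` is `q` turned by a right angle. If x = p + a q + b n has distances r and r' to `p` and
  -- `p'`, then a = (r² − r'² + D)/(2D), which is `α`, and b² = r²/D − a². So `Ψ 1` and `Ψ (-1)`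
  -- recover from (r, r') the points off the line b = 0. On `Y` the radicand is positive, so they
  -- are differentiable and preserve null sets.
  set n : Plane := !₂[-q 1, q 0] with hn
  set α : Plane → ℝ := fun y => (y 0 ^ 2 - y 1 ^ 2 + D) / (2 * D) with hα
  set Y : Set Plane := {y | (y 0, y 1) ∈ S ∧ 0 < y 0 ^ 2 / D - α y ^ 2} with hY
  set Ψ : ℝ → Plane → Plane := fun ε y =>
    p + α y • q + (ε * √(y 0 ^ 2 / D - α y ^ 2)) • n with hΨ
  have hYnull : volume Y = 0 :=
    measure_mono_null (fun y hy => hy.1) (volume_preimage_coordinates_eq_zero hS)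
  have hΨnull : ∀ ε, volume (Ψ ε '' Y) = 0 := fun ε => by
    refine addHaar_image_eq_zero_of_differentiableOn_of_addHaar_eq_zero
      (volume : Measure Plane) (fun y hy => ?_) hYnull
    have h0 : y 0 ^ 2 / D - α y ^ 2 ≠ 0 := hy.2.ne'
    have h1 : DifferentiableAt ℝ (fun y : Plane => y 0 ^ 2 / D - α y ^ 2) y := by
      simp only [hα]; fun_prop
    have h2 : DifferentiableAt ℝ α y := by simp only [hα]; fun_prop
    have h3 := h1.sqrt h0
    refine DifferentiableAt.differentiableWithinAt ?_
    simp only [hΨ]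
    fun_prop
  refine measure_mono_null ?_
    (measure_union_null (volume_line_eq_zero p q) (measure_union_null (hΨnull 1) (hΨnull (-1))))
  intro x hx
  set a := ((x 0 - p 0) * q 0 + (x 1 - p 1) * q 1) / D with ha
  set b := (-(x 0 - p 0) * q 1 + (x 1 - p 1) * q 0) / D with hb
  have hx0 : x 0 = p 0 + a * q 0 - b * q 1 := by
    rw [ha, hb]; field_simp; rw [hD]; ring
  have hx1 : x 1 = p 1 + a * q 1 + b * q 0 := by
    rw [ha, hb]; field_simp; rw [hD]; ring
  have hxab : x = p + a • q + b • n := by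
    ext i
    fin_cases i
    · simp [hn, hx0]; ring
    · simp [hn, hx1]
  by_cases hb0 : b = 0
  · left
    exact ⟨a, by rw [hb0] at hxab; simpa using hxab⟩
  right
  set y : Plane := !₂[dist x p, dist x p'] with hy
  have hy0 : y 0 ^ 2 = (a ^ 2 + b ^ 2) * D := by
    have : y 0 = dist x p := by simp [hy]
    rw [this, dist_sq_eq_coordinates, hx0, hx1, hD]; ring
  have hp' : ∀ i, p' i = p i + q i := fun i => by simp [hq]
  have hy1 : y 1 ^ 2 = ((a - 1) ^ 2 + b ^ 2) * D := by
    have : y 1 = dist x p' := by simp [hy]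
    rw [this, dist_sq_eq_coordinates, hx0, hx1, hp', hp', hD]; ring
  have hαy : α y = a := by
    simp only [hα, hy0, hy1]; field_simp; ring
  have hrad : y 0 ^ 2 / D - α y ^ 2 = b ^ 2 := by
    rw [hαy, hy0]; field_simp; ring
  have hyY : y ∈ Y := ⟨by simpa [hy] using hx, by rw [hrad]; positivity⟩
  rcases lt_or_gt_of_ne hb0 with hneg | hpos
  · right
    refine ⟨y, hyY, ?_⟩
    simp only [hΨ]
    rw [hrad, hαy, Real.sqrt_sq_eq_abs, abs_of_neg hneg, neg_one_mul, neg_neg, ← hxab]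
  · left
    refine ⟨y, hyY, ?_⟩
    simp only [hΨ]
    rw [hrad, hαy, Real.sqrt_sq_eq_abs, abs_of_pos hpos, one_mul, ← hxab]

/-- If `F` has null level sets, then `F (dist x p)` and `F (dist x p')` differ by a given constant
only on a null set. -/
lemma volume_tie_eq_zero {F : ℝ → ℝ} (hF : ContinuousOn F (Ici 0))
    (hlevel : ∀ c : ℝ, volume {r : ℝ | 0 ≤ r ∧ F r = c} = 0) {p p' : Plane} (hp : p ≠ p')
    (c : ℝ) : volume {x : Plane | F (dist x p) = F (dist x p') + c} = 0 := by
  refine measure_mono_null ?_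
    (volume_dist_pair_eq_zero hp (volume_radii_difference_eq_zero hF hlevel c))
  exact fun x hx => ⟨dist_nonneg, dist_nonneg, hx⟩

end PlaneGeometry

/-! ### The measure with density `lam` on Ω -/

section PopulationMeasure

/-- The measure on the plane with density `lam` on `Ω`. -/
noncomputable def populationMeasure (Ω : Set Plane) (lam : Plane → ℝ) : Measure Plane :=
  (volume.restrict Ω).withDensity fun x => ENNReal.ofReal (lam x)

variable {Ω : Set Plane} {lam : Plane → ℝ}

lemma populationMeasure_absolutelyContinuous (Ω : Set Plane) (lam : Plane → ℝ) :
    populationMeasure Ω lam ≪ volume :=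
  (withDensity_absolutelyContinuous _ _).trans Measure.restrict_le_self.absolutelyContinuous

lemma isFiniteMeasure_populationMeasure (hint : IntegrableOn lam Ω) :
    IsFiniteMeasure (populationMeasure Ω lam) :=
  isFiniteMeasure_withDensity_ofReal hint.2

lemma setIntegral_populationMeasure (hnonneg : ∀ x ∈ Ω, 0 ≤ lam x) (hint : IntegrableOn lam Ω)
    (g : Plane → ℝ) {A : Set Plane} (hA : MeasurableSet A) (hAΩ : A ⊆ Ω) :
    ∫ x in A, g x ∂populationMeasure Ω lam = ∫ x in A, g x * lam x := by
  rw [populationMeasure, setIntegral_withDensity_eq_setIntegral_toReal_smul₀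
    (hint.1.aemeasurable.ennreal_ofReal.mono_measure Measure.restrict_le_self)
    (Eventually.of_forall fun x => ENNReal.ofReal_lt_top) g hA,
    Measure.restrict_restrict_of_subset hAΩ]
  refine setIntegral_congr_fun hA fun x hx => ?_
  simp only [ENNReal.toReal_ofReal (hnonneg x (hAΩ hx)), smul_eq_mul, mul_comm]

lemma mass_eq_measureReal (hnonneg : ∀ x ∈ Ω, 0 ≤ lam x) (hint : IntegrableOn lam Ω)
    {A : Set Plane} (hA : MeasurableSet A) (hAΩ : A ⊆ Ω) :
    mass lam A = (populationMeasure Ω lam).real A := by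
  have h := setIntegral_populationMeasure hnonneg hint (fun _ => 1) hA hAΩ
  simp only [one_mul, setIntegral_const, smul_eq_mul, mul_one] at h
  exact h.symm

lemma populationMeasure_compl (Ω : Set Plane) (hΩ : MeasurableSet Ω) (lam : Plane → ℝ) :
    populationMeasure Ω lam Ωᶜ = 0 :=
  withDensity_absolutelyContinuous _ _ (by rw [Measure.restrict_apply hΩ.compl]; simp)

lemma isProbabilityMeasure_populationMeasure (hΩ : MeasurableSet Ω)
    (hnonneg : ∀ x ∈ Ω, 0 ≤ lam x) (hint : IntegrableOn lam Ω) (hmass : mass lam Ω = 1) :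
    IsProbabilityMeasure (populationMeasure Ω lam) := by
  have := isFiniteMeasure_populationMeasure hint
  rw [mass_eq_measureReal hnonneg hint hΩ Subset.rfl] at hmass
  have h := measureReal_add_measureReal_compl (μ := populationMeasure Ω lam) hΩ
  rw [hmass, measureReal_def _ Ωᶜ, populationMeasure_compl Ω hΩ lam, ENNReal.toReal_zero,
    add_zero] at h
  exact ⟨by rw [← ENNReal.toReal_eq_one_iff, ← measureReal_def]; exact h.symm⟩

lemma integrable_populationMeasure (hΩ : MeasurableSet Ω) (hnonneg : ∀ x ∈ Ω, 0 ≤ lam x)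
    (hint : IntegrableOn lam Ω) {g : Plane → ℝ} (hg : IntegrableOn (fun x => g x * lam x) Ω) :
    Integrable g (populationMeasure Ω lam) := by
  rw [populationMeasure, integrable_withDensity_iff_integrable_smul₀'
    hint.1.aemeasurable.ennreal_ofReal (Eventually.of_forall fun x => ENNReal.ofReal_lt_top)]
  refine (integrableOn_congr_fun (fun x hx => ?_) hΩ).1 hg
  simp only [ENNReal.toReal_ofReal (hnonneg x hx), smul_eq_mul, mul_comm]

end PopulationMeasure

/-! ### Convexity and derivative of the congestion cost -/

section CongestionCost

variable {s : ℝ → ℝ}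

/-- The total congestion cost `t * s t` lies above its tangents. -/
lemma tangent_le_congestion (hdiff : DifferentiableOn ℝ s (Icc 0 1))
    (hmono : MonotoneOn s (Icc 0 1)) (hconv : ConvexOn ℝ (Icc 0 1) s) {a b : ℝ}
    (ha : a ∈ Icc (0 : ℝ) 1) (hb : b ∈ Icc (0 : ℝ) 1) :
    a * s a + (s a + a * derivWithin s (Icc 0 1) a) * (b - a) ≤ b * s b := by
  have hd : 0 ≤ derivWithin s (Icc 0 1) a := hmono.derivWithin_nonneg
  have htan : s a + derivWithin s (Icc 0 1) a * (b - a) ≤ s b := by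
    rcases lt_trichotomy a b with h | rfl | h
    · have := hconv.derivWithin_le_slope ha hb h (hdiff a ha)
      rw [slope_def_field, le_div_iff₀ (sub_pos.2 h)] at this
      linarith
    · simp
    · have := hconv.slope_le_derivWithin hb ha h (hdiff a ha)
      rw [slope_def_field, div_le_iff₀ (sub_pos.2 h)] at this
      linarith
  -- Multiplying the tangent inequality of `s` by `b` overshoots the tangent of t s(t) by s'(a)(b −
  -- a)², nonnegative by monotonicity.
  have h1 := mul_le_mul_of_nonneg_left htan hb.1
  have h2 := mul_nonneg hd (sq_nonneg (b - a))
  linarith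

lemma hasDerivWithinAt_congestion (hdiff : DifferentiableOn ℝ s (Icc 0 1)) {t : ℝ}
    (ht : t ∈ Icc (0 : ℝ) 1) :
    HasDerivWithinAt (fun t => t * s t) (s t + t * derivWithin s (Icc 0 1) t) (Icc 0 1) t := by
  simpa using (hasDerivWithinAt_id t (Icc 0 1)).fun_mul (hdiff t ht).hasDerivWithinAt

end CongestionCost

/-! ### Optimality criterion and existence of the cells -/

section Optimality

variable {K : ℕ} {Ω : Set Plane} {lam : Plane → ℝ} {p : Fin K → Plane} {F : ℝ → ℝ}
  {s : Fin K → ℝ → ℝ}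

lemma IsCellPartition.subset {C : Fin K → Set Plane} (hC : IsCellPartition Ω lam C) (i : Fin K) :
    C i ⊆ Ω :=
  hC.cover ▸ subset_iUnion C i

lemma measurable_comp_dist (hF : ContinuousOn F (Ici 0)) (a : Plane) :
    Measurable fun x : Plane => F (dist x a) :=
  (hF.comp_continuous (continuous_id.dist continuous_const) fun _ => dist_nonneg).measurable

lemma mass_mem_Icc (hΩ : MeasurableSet Ω) (hnonneg : ∀ x ∈ Ω, 0 ≤ lam x)
    (hint : IntegrableOn lam Ω) (hmass : mass lam Ω = 1) {A : Set Plane} (hA : MeasurableSet A)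
    (hAΩ : A ⊆ Ω) : mass lam A ∈ Icc (0 : ℝ) 1 := by
  have := isProbabilityMeasure_populationMeasure hΩ hnonneg hint hmass
  rw [mass_eq_measureReal hnonneg hint hA hAΩ]
  exact ⟨measureReal_nonneg, measureReal_le_one⟩

lemma cost_eq (hnonneg : ∀ x ∈ Ω, 0 ≤ lam x)
    (hint : IntegrableOn lam Ω)
    (hfi : ∀ i, Integrable (fun x => F (dist x (p i))) (populationMeasure Ω lam))
    {C : Fin K → Set Plane} (hC : IsCellPartition Ω lam C) :
    cost p lam F s C = ∑ i, ((∫ x in C i, F (dist x (p i)) ∂populationMeasure Ω lam)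
      + mass lam (C i) * s i (mass lam (C i))) := by
  have := isFiniteMeasure_populationMeasure hint
  refine Finset.sum_congr rfl fun i _ => ?_
  rw [← setIntegral_populationMeasure hnonneg hint _ (hC.measurable i) (hC.subset i),
    integral_add (hfi i).integrableOn (integrable_const _), setIntegral_const, smul_eq_mul,
    ← mass_eq_measureReal hnonneg hint (hC.measurable i) (hC.subset i)]

/-- The integral over `Ω` is the sum of the integrals over the cells. -/
lemma sum_setIntegral_cells (hnonneg : ∀ x ∈ Ω, 0 ≤ lam x) (hint : IntegrableOn lam Ω)
    {C : Fin K → Set Plane} (hC : IsCellPartition Ω lam C) {g : Plane → ℝ}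
    (hg : Integrable g (populationMeasure Ω lam)) :
    ∑ i, ∫ x in C i, g x ∂populationMeasure Ω lam = ∫ x in Ω, g x ∂populationMeasure Ω lam := by
  have := isFiniteMeasure_populationMeasure hint
  have h := integral_iUnion_ae (f := g) (fun i => (hC.measurable i).nullMeasurableSet)
    (fun i j hij => ?_) hg.integrableOn
  · rw [hC.cover, tsum_fintype] at h
    exact h.symm
  have h := hC.overlap i j hij
  rwa [mass_eq_measureReal hnonneg hint ((hC.measurable i).inter (hC.measurable j))
    (inter_subset_left.trans (hC.subset i)), measureReal_eq_zero_iff] at h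

/-- A cell partition with cells contained in the minimal cells of its own masses solves the
problem: the total congestion costs are convex. -/
theorem solvesP1_of_subset_minCell (hΩ : MeasurableSet Ω) (hnonneg : ∀ x ∈ Ω, 0 ≤ lam x)
    (hint : IntegrableOn lam Ω) (hmass : mass lam Ω = 1) (hF : ContinuousOn F (Ici 0))
    (hF_int : ∀ i, IntegrableOn (fun x => F (dist x (p i)) * lam x) Ω)
    (hs_diff : ∀ i, DifferentiableOn ℝ (s i) (Icc 0 1))
    (hs_mono : ∀ i, MonotoneOn (s i) (Icc 0 1)) (hs_conv : ∀ i, ConvexOn ℝ (Icc 0 1) (s i))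
    {C : Fin K → Set Plane} (hC : IsCellPartition Ω lam C)
    (hmin : ∀ i, C i ⊆ minCell Ω p F s (fun j => mass lam (C j)) i) :
    SolvesP1 Ω p lam F s C := by
  refine ⟨hC, fun B hB => ?_⟩
  rcases isEmpty_or_nonempty (Fin K) with hK | hK
  · simp [cost]
  have hprob := isProbabilityMeasure_populationMeasure hΩ hnonneg hint hmass
  have hfi : ∀ i, Integrable (fun x => F (dist x (p i))) (populationMeasure Ω lam) := fun i =>
    integrable_populationMeasure hΩ hnonneg hint (hF_int i)
  set μ := populationMeasure Ω lam with hμ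
  set N : Fin K → ℝ := fun i => mass lam (C i) with hN
  set v : Fin K → ℝ := fun i => s i (N i) + N i * derivWithin (s i) (Icc 0 1) (N i) with hv
  have hlevel : ∀ i x, level p F s N i x = F (dist x (p i)) + v i := fun i x => by
    simp only [level, hv, add_assoc]
  -- The integrand f_i + v_i equals `e` on `C i` and is at least `e` on any competing cell. Both
  -- families of cells integrate `e` to its integral over Ω, so `C` minimizes the linearized cost;
  -- `htan` passes to the true cost.
  set e : Plane → ℝ := fun x => ⨅ i, (F (dist x (p i)) + v i) with he
  have hei : Integrable e μ :=
    integrable_envelope (fun i => measurable_comp_dist hF (p i)) hfi v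
  have hshift : ∀ {A : Fin K → Set Plane}, IsCellPartition Ω lam A → ∀ i,
      ∫ x in A i, (F (dist x (p i)) + v i) ∂μ
        = (∫ x in A i, F (dist x (p i)) ∂μ) + mass lam (A i) * v i := fun {A} hA i => by
    rw [integral_add (hfi i).integrableOn (integrable_const _), setIntegral_const, smul_eq_mul,
      ← mass_eq_measureReal hnonneg hint (hA.measurable i) (hA.subset i)]
  have hCe : ∀ i, ∫ x in C i, (F (dist x (p i)) + v i) ∂μ = ∫ x in C i, e x ∂μ := fun i =>
    setIntegral_congr_fun (hC.measurable i) fun x hx =>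
      (iInf_eq_of_forall_le (a := fun j => F (dist x (p j)) + v j) fun j => by
        simpa only [hlevel] using (hmin i hx).2 j).symm
  have hBe : ∀ i, ∫ x in B i, e x ∂μ ≤ ∫ x in B i, (F (dist x (p i)) + v i) ∂μ := fun i =>
    setIntegral_mono hei.integrableOn ((hfi i).add (integrable_const _)).integrableOn
      fun x => iInf_le_of_finite _ i
  have htan : ∀ i, N i * s i (N i) + v i * (mass lam (B i) - N i)
      ≤ mass lam (B i) * s i (mass lam (B i)) := fun i =>
    tangent_le_congestion (hs_diff i) (hs_mono i) (hs_conv i)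
      (mass_mem_Icc hΩ hnonneg hint hmass (hC.measurable i) (hC.subset i))
      (mass_mem_Icc hΩ hnonneg hint hmass (hB.measurable i) (hB.subset i))
  have htotal : ∑ i, ∫ x in C i, (F (dist x (p i)) + v i) ∂μ
      ≤ ∑ i, ∫ x in B i, (F (dist x (p i)) + v i) ∂μ := by
    rw [Finset.sum_congr rfl fun i _ => hCe i, sum_setIntegral_cells hnonneg hint hC hei,
      ← sum_setIntegral_cells hnonneg hint hB hei]
    exact Finset.sum_le_sum fun i _ => hBe i
  rw [Finset.sum_congr rfl fun i _ => hshift hC i, Finset.sum_congr rfl fun i _ => hshift hB i,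
    Finset.sum_add_distrib, Finset.sum_add_distrib] at htotal
  rw [cost_eq hnonneg hint hfi hC, cost_eq hnonneg hint hfi hB, Finset.sum_add_distrib,
    Finset.sum_add_distrib]
  have hsum := Finset.sum_le_sum fun i (_ : i ∈ Finset.univ) => htan i
  rw [Finset.sum_add_distrib] at hsum
  have hexp : ∑ i, v i * (mass lam (B i) - N i)
      = ∑ i, mass lam (B i) * v i - ∑ i, mass lam (C i) * v i := by
    rw [← Finset.sum_sub_distrib]
    exact Finset.sum_congr rfl fun i _ => by simp only [hN]; ring
  rw [hexp] at hsum
  linarith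

/-- There is a partition into disjoint cells, each contained in its minimal cell. -/
theorem exists_partition_subset_minCell (hK : 0 < K) (hΩ : MeasurableSet Ω)
    (hnonneg : ∀ x ∈ Ω, 0 ≤ lam x)
    (hint : IntegrableOn lam Ω) (hmass : mass lam Ω = 1) (hF : ContinuousOn F (Ici 0))
    (hF_int : ∀ i, IntegrableOn (fun x => F (dist x (p i)) * lam x) Ω)
    (hs_diff : ∀ i, DifferentiableOn ℝ (s i) (Icc 0 1)) :
    ∃ C : Fin K → Set Plane, IsCellPartition Ω lam C ∧ (∀ i j, i ≠ j → Disjoint (C i) (C j)) ∧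
      ∀ i, C i ⊆ minCell Ω p F s (fun j => mass lam (C j)) i := by
  have : Nonempty (Fin K) := ⟨⟨0, hK⟩⟩
  have hprob := isProbabilityMeasure_populationMeasure hΩ hnonneg hint hmass
  have hf : ∀ i, Measurable fun x : Plane => F (dist x (p i)) := fun i =>
    measurable_comp_dist hF (p i)
  have hfi : ∀ i, Integrable (fun x => F (dist x (p i))) (populationMeasure Ω lam) := fun i =>
    integrable_populationMeasure hΩ hnonneg hint (hF_int i)
  obtain ⟨N, -, hsuper⟩ := exists_supergradient_at_marginal_cost hf hfi
    (G := fun i t => t * s i t) fun i t ht => hasDerivWithinAt_congestion (hs_diff i) ht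
  -- The first coordinate serves as the diffuse function: its fibers are lines, null for a measure
  -- with a density.
  obtain ⟨σ, hσ, hσmin, hσN⟩ := exists_selection_of_supergradient
    (q := fun x : Plane => x 0) (by fun_prop)
    (fun t => populationMeasure_absolutelyContinuous Ω lam (volume_coordinate_zero_eq t))
    hf hfi hsuper
  have hCm : ∀ i, MeasurableSet (Ω ∩ σ ⁻¹' {i}) := fun i =>
    hΩ.inter (hσ (measurableSet_singleton i))
  have hdisj : ∀ i j, i ≠ j → Disjoint (Ω ∩ σ ⁻¹' {i}) (Ω ∩ σ ⁻¹' {j}) := fun i j hij =>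
    ((disjoint_singleton.2 hij).preimage σ).mono inter_subset_right inter_subset_right
  have hCN : ∀ i, mass lam (Ω ∩ σ ⁻¹' {i}) = N i := fun i => by
    rw [mass_eq_measureReal hnonneg hint (hCm i) inter_subset_left, ← hσN i, measureReal_def,
      measureReal_def, inter_comm, measure_inter_conull (populationMeasure_compl Ω hΩ lam)]
  refine ⟨fun i => Ω ∩ σ ⁻¹' {i}, ⟨hCm, ?_, fun i j hij => ?_⟩, hdisj, fun i x hx => ?_⟩
  · ext x
    simp
  · rw [(hdisj i j hij).inter_eq, mass]
    simp
  · refine ⟨hx.1, fun j => ?_⟩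
    have hxi : σ x = i := hx.2
    have h := hσmin x j
    simp only [hxi] at h
    simp only [hCN, level, add_assoc]
    exact h

/-- Cells which cover `Ω` and are contained in the minimal cells contain the strict ones. -/
lemma strictMinCell_subset {N : Fin K → ℝ} {C : Fin K → Set Plane} (hcover : ⋃ i, C i = Ω)
    (hmin : ∀ i, C i ⊆ minCell Ω p F s N i) (i : Fin K) :
    strictMinCell Ω p F s N i ⊆ C i := by
  intro x hx
  obtain ⟨j, hj⟩ := mem_iUnion.1 (hcover.symm ▸ hx.1)
  by_cases hji : j = i
  · exact hji ▸ hj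
  · exact absurd ((hmin j hj).2 i) (not_le.2 (hx.2 j hji))

/-- Two different minimal cells overlap in a null set. -/
lemma volume_minCell_inter_eq_zero (hF : ContinuousOn F (Ici 0)) (hp : Function.Injective p)
    (hlevel : ∀ c : ℝ, volume {r : ℝ | 0 ≤ r ∧ F r = c} = 0) (N : Fin K → ℝ) {i j : Fin K}
    (hij : i ≠ j) : volume (minCell Ω p F s N i ∩ minCell Ω p F s N j) = 0 := by
  refine measure_mono_null ?_ (volume_tie_eq_zero hF hlevel (hp.ne hij)
    (s j (N j) + N j * derivWithin (s j) (Icc 0 1) (N j)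
      - (s i (N i) + N i * derivWithin (s i) (Icc 0 1) (N i))))
  rintro x ⟨hi, hj⟩
  have h := le_antisymm (hi.2 j) (hj.2 i)
  simp only [level] at h
  rw [mem_ofPred_eq]
  linarith

lemma measurableSet_minCell (hΩ : MeasurableSet Ω) (hF : ContinuousOn F (Ici 0))
    (N : Fin K → ℝ) (i : Fin K) : MeasurableSet (minCell Ω p F s N i) := by
  have hm : ∀ j, Measurable (level p F s N j) := fun j =>
    ((measurable_comp_dist hF (p j)).add_const _).add_const _
  simp only [minCell, ofPred_and, ofPred_forall]
  exact hΩ.inter (MeasurableSet.iInter fun j => measurableSet_le (hm i) (hm j))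

end Optimality

end CellAssociation


theorem mainTheorem1 {K : ℕ} (hK : 0 < K)
    (Ω : Set CellAssociation.Plane) (hΩ : MeasurableSet Ω)
    (lam : CellAssociation.Plane → ℝ) (hlam_nonneg : ∀ x ∈ Ω, 0 ≤ lam x)
    (hlam_int : MeasureTheory.IntegrableOn lam Ω) (hlam_mass : CellAssociation.mass lam Ω = 1)
    (p : Fin K → CellAssociation.Plane)
    (F : ℝ → ℝ) (hF : ContinuousOn F (Set.Ici 0))
    (hF_int : ∀ i, MeasureTheory.IntegrableOn (fun x => F (dist x (p i)) * lam x) Ω)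
    (s : Fin K → ℝ → ℝ)
    (hs_diff : ∀ i, ContDiffOn ℝ 1 (s i) (Set.Icc 0 1))
    (hs_mono : ∀ i, MonotoneOn (s i) (Set.Icc 0 1))
    (hs_conv : ∀ i, ConvexOn ℝ (Set.Icc 0 1) (s i)) :
    -- For every continuous `F`: a solution of (P1) with pairwise disjoint cells that satisfies
    -- (S1), points where several indices are minimal being given to one of these indices.
    (∃ C : Fin K → Set CellAssociation.Plane,
      CellAssociation.SolvesP1 Ω p lam F s C ∧
      (∀ i j, i ≠ j → Disjoint (C i) (C j)) ∧
      ∀ i,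
        CellAssociation.strictMinCell Ω p F s (fun j => CellAssociation.mass lam (C j)) i ⊆ C i ∧
        C i ⊆ CellAssociation.minCell Ω p F s (fun j => CellAssociation.mass lam (C j)) i) ∧
    -- If the base stations are distinct and the level sets of `F` are null: a solution of (P1)
    -- that satisfies (S1) with equality of sets.
    (Function.Injective p →
      (∀ c : ℝ, MeasureTheory.volume {r : ℝ | 0 ≤ r ∧ F r = c} = 0) →
      ∃ C : Fin K → Set CellAssociation.Plane,
        CellAssociation.SolvesP1 Ω p lam F s C ∧
        ∀ i, C i =
          CellAssociation.minCell Ω p F s (fun j => CellAssociation.mass lam (C j)) i) := by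

  have hdiff : ∀ i, DifferentiableOn ℝ (s i) (Icc 0 1) := fun i =>
    (hs_diff i).differentiableOn one_ne_zero
  obtain ⟨C, hC, hdisj, hmin⟩ := CellAssociation.exists_partition_subset_minCell (p := p) (s := s)
    hK hΩ hlam_nonneg hlam_int hlam_mass hF hF_int hdiff
  refine ⟨⟨C, CellAssociation.solvesP1_of_subset_minCell hΩ hlam_nonneg hlam_int hlam_mass hF
    hF_int hdiff hs_mono hs_conv hC hmin, hdisj, fun i =>
      ⟨CellAssociation.strictMinCell_subset hC.cover hmin i, hmin i⟩⟩, fun hp hlevel => ?_⟩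
  set N : Fin K → ℝ := fun j => CellAssociation.mass lam (C j) with hN
  -- The minimal cells are formed with the masses of `C`. Passing from `C i` to `B i` adds only
  -- ties, which are null, so `N` is also the mass vector of `B` and the optimality criterion
  -- applies to `B`.
  set B : Fin K → Set CellAssociation.Plane := CellAssociation.minCell Ω p F s N with hB
  have hnull : ∀ i j, i ≠ j → volume (B i ∩ B j) = 0 := fun i j hij =>
    CellAssociation.volume_minCell_inter_eq_zero hF hp hlevel N hij
  have hcover : ⋃ i, B i = Ω := by
    refine Subset.antisymm (iUnion_subset fun i x hx => hx.1) ?_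
    rw [← hC.cover]
    exact iUnion_mono hmin
  have hmass : ∀ i, CellAssociation.mass lam (B i) = N i := fun i => by
    refine setIntegral_congr_set ((LE.le.eventuallyLE (hmin i)).antisymm ?_).symm
    rw [ae_le_set]
    refine measure_mono_null (t := ⋃ j, ⋃ _ : i ≠ j, B i ∩ B j) ?_
      (measure_iUnion_null fun j => measure_iUnion_null fun hij => hnull i j hij)
    rintro x ⟨hxB, hxC⟩
    obtain ⟨j, hj⟩ := mem_iUnion.1 (hC.cover.symm ▸ hxB.1)
    have hij : i ≠ j := fun h => hxC (h ▸ hj)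
    exact mem_iUnion₂.2 ⟨j, hij, hxB, hmin j hj⟩
  have hBN : (fun j => CellAssociation.mass lam (B j)) = N := funext hmass
  have hBp : CellAssociation.IsCellPartition Ω lam B :=
    ⟨CellAssociation.measurableSet_minCell hΩ hF N, hcover, fun i j hij =>
      setIntegral_measure_zero _ (hnull i j hij)⟩
  refine ⟨B, CellAssociation.solvesP1_of_subset_minCell hΩ hlam_nonneg hlam_int hlam_mass hF
    hF_int hdiff hs_mono hs_conv hBp fun i => ?_, fun i => ?_⟩
  · rw [hBN]
  · rw [hBN]
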